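/- Let $\mathbb D$ be the open unit disk of $\mathbb C$ and let $H^\infty$ be the space of bounded analytic functions in $\mathbb D$. For a finite positive Borel measure $\mu$ on $[0,1)$ put $\mu_n=\int_{[0,1)}t^n\,d\mu(t)$, and for $f(z)=\sum_{n\ge 0}a_nz^n$ analytic in $\mathbb D$ define the Cesàro-like operator $$\mathcal C_\mu(f)(z)=\sum_{n=0}^\infty\Big(\mu_n\sum_{k=0}^n a_k\Big)z^n,\qquad z\in\mathbb D.$$ For $0<p<\infty$ let $\mathcal Q_p$ be the space of all functions $f$ analytic in $\mathbb D$ with $$\sup_{w\in\mathbb D}\int_{\mathbb D}|f'(z)|^2\big(1-|\sigma_w(z)|^2\big)^p\,dA(z)<\infty,\qquad \sigma_w(z)=\frac{w-z}{1-\overline w z},$$ where $dA$ is area measure normalized so that $A(\mathbb D)=1$. **Theorem.** Let $0<p<2$ and let $\mu$ be a finite positive Borel measure on $[0,1)$. Then $\mathcal C_\mu(H^\infty)\subseteq\mathcal Q_p$ if and only if $\mu$ is a Carleson measure, i.e. there is a constant $C>0$ such that $\mu([t,1))\le C(1-t)$ for all $t\in[0,1)$. -/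

import Mathlib

open scoped ENNReal ComplexConjugate

noncomputable section

/-- The open unit disk `𝔻` of the complex plane. -/
def unitDisk : Set ℂ := Metric.ball (0 : ℂ) 1

/-- `H(𝔻)`: the functions analytic in the unit disk (only the values on `𝔻` matter). -/
def analyticDisk : Set (ℂ → ℂ) := {f | DifferentiableOn ℂ f unitDisk}

/-- `H^∞`: the bounded analytic functions in the unit disk. -/
def hardyInfty : Set (ℂ → ℂ) :=
  {f | f ∈ analyticDisk ∧ ∃ M : ℝ, ∀ z ∈ unitDisk, ‖f z‖ ≤ M}

/-- The `n`-th Taylor coefficient of `f` at the origin. -/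
def taylorCoeff (f : ℂ → ℂ) (n : ℕ) : ℂ := iteratedDeriv n f 0 / (n.factorial : ℂ)

/-- The Möbius map `σ_a(z) = (a - z) / (1 - conj a * z)`. -/
def mobius (a z : ℂ) : ℂ := (a - z) / (1 - conj a * z)

/-- Area measure on `ℂ`, normalized so that the unit disk has measure `1`. -/
def normalizedArea : MeasureTheory.Measure ℂ :=
  (ENNReal.ofReal Real.pi)⁻¹ • MeasureTheory.volume

/-- The squared seminorm
`sup_{w ∈ 𝔻} ∫_𝔻 |f'(z)|² (1 - |σ_w(z)|²)^p dA(z)`, as an element of `[0, ∞]`. -/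
def qSeminormSq (p : ℝ) (f : ℂ → ℂ) : ℝ≥0∞ :=
  ⨆ w ∈ unitDisk, ∫⁻ z in unitDisk,
    ENNReal.ofReal (‖deriv f z‖ ^ 2 * (1 - ‖mobius w z‖ ^ 2) ^ p) ∂normalizedArea

/-- The Möbius invariant space `Q_p`. -/
def qSpace (p : ℝ) : Set (ℂ → ℂ) := {f | f ∈ analyticDisk ∧ qSeminormSq p f < ∞}

/-- The moment `μ_n = ∫_{[0,1)} t^n dμ(t)` of a measure on `[0,1)`. -/
def moment01 (μ : MeasureTheory.Measure (Set.Ico (0 : ℝ) 1)) (n : ℕ) : ℝ :=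
  ∫ t, (t : ℝ) ^ n ∂μ

/-- The Cesàro-like operator
`C_μ(f)(z) = ∑_n (μ_n ∑_{k ≤ n} a_k) z^n` for `f(z) = ∑_n a_n z^n` in `H(𝔻)`. -/
def cesaroLike (μ : MeasureTheory.Measure (Set.Ico (0 : ℝ) 1)) (f : ℂ → ℂ) (z : ℂ) : ℂ :=
  ∑' n : ℕ, ((moment01 μ n : ℂ) * ∑ k ∈ Finset.range (n + 1), taylorCoeff f k) * z ^ n

/-- `μ` is a Carleson measure on `[0,1)`: `μ([t,1)) ≤ C (1 - t)` for all `t ∈ [0,1)`. -/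
def IsCarleson01 (μ : MeasureTheory.Measure (Set.Ico (0 : ℝ) 1)) : Prop :=
  ∃ C : ℝ, 0 < C ∧ ∀ t : Set.Ico (0 : ℝ) 1, μ (Set.Ici t) ≤ ENNReal.ofReal (C * (1 - t))

end

/-- The unit disk has area `1`. -/
theorem normalizedArea_unitDisk : normalizedArea unitDisk = 1 := by
  have h : ENNReal.ofReal Real.pi ≠ 0 := by
    simpa using Real.pi_pos
  simp only [normalizedArea, unitDisk, MeasureTheory.Measure.smul_apply, Complex.volume_ball,
    smul_eq_mul]
  rw [show (NNReal.pi : ℝ≥0∞) = ENNReal.ofReal Real.pi by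
    rw [← NNReal.coe_real_pi, ENNReal.ofReal_coe_nnreal]]
  simp [ENNReal.inv_mul_cancel h ENNReal.ofReal_ne_top]

/-- The series that defines the Cesàro-like operator converges absolutely in the unit disk. -/
theorem summable_cesaroLike (μ : MeasureTheory.Measure (Set.Ico (0 : ℝ) 1))
    [MeasureTheory.IsFiniteMeasure μ] {f : ℂ → ℂ} (hf : f ∈ analyticDisk) {z : ℂ}
    (hz : z ∈ unitDisk) :
    Summable fun n : ℕ =>
      ‖((moment01 μ n : ℂ) * ∑ k ∈ Finset.range (n + 1), taylorCoeff f k) * z ^ n‖ := by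
  have hz1 : ‖z‖ < 1 := by simpa [unitDisk] using hz
  have ha : Summable fun n : ℕ => ‖taylorCoeff f n * z ^ n‖ := by
    have h := (Complex.hasSum_taylorSeries_on_ball (c := 0) (r := 1) (f := f)
      (by simpa [analyticDisk, unitDisk] using hf) (z := z)
      (by simpa [unitDisk] using hz)).summable.norm
    refine h.congr fun n => ?_
    congr 1
    simp only [taylorCoeff, smul_eq_mul, sub_zero]
    ring
  have hg : Summable fun n : ℕ => ‖z ^ n‖ := by
    simpa using summable_geometric_of_lt_one (norm_nonneg z) hz1
  have hs := summable_norm_sum_mul_antidiagonal_of_summable_norm ha hg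
  have hm : ∀ n, ‖(moment01 μ n : ℂ)‖ ≤ 1 * μ.real Set.univ := by
    intro n
    rw [Complex.norm_real]
    refine MeasureTheory.norm_integral_le_of_norm_le_const (Filter.Eventually.of_forall ?_)
    intro t
    rw [norm_pow, Real.norm_of_nonneg t.2.1]
    exact pow_le_one₀ t.2.1 t.2.2.le
  refine Summable.of_nonneg_of_le (fun n => norm_nonneg _) (fun n => ?_)
    (hs.mul_left (1 * μ.real Set.univ))
  have he : (∑ k ∈ Finset.range (n + 1), taylorCoeff f k) * z ^ n
      = ∑ kl ∈ Finset.HasAntidiagonal.antidiagonal n, (taylorCoeff f kl.1 * z ^ kl.1) * z ^ kl.2 := by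
    rw [Finset.Nat.sum_antidiagonal_eq_sum_range_succ
      (fun i j => (taylorCoeff f i * z ^ i) * z ^ j), Finset.sum_mul]
    refine Finset.sum_congr rfl fun k hk => ?_
    rw [mul_assoc, ← pow_add, Nat.add_sub_cancel' (Nat.lt_succ_iff.mp (Finset.mem_range.mp hk))]
  rw [mul_assoc, norm_mul, he]
  exact mul_le_mul_of_nonneg_right (hm n) (norm_nonneg _)

open MeasureTheory Metric

/-! Everything rests on `cesaroLike_eq_integral`: `C_μ f(z) = ∫ f(tz)/(1 - tz) dμ(t)`.

Sufficiency. For bounded `f`, the `z`-derivative of the kernel is `O(1/((1 - t|z|) |1 - tz|))`.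
Interpolating between lower bounds for `|1 - tz|` and integrating against a Carleson measure gives
`|(C_μ f)'(z)| ≤ K |1 - z|^(ε-1) (1 - |z|)^(-ε)` for every `0 < ε < 1`
(`exists_norm_deriv_cesaroLike_le`). With `ε = p/2`, the powers of `1 - |z|` cancel in the `Q_p`
integral. What remains is `∫ (1 - |w|)^p |1 - z|^(p-2) |1 - conj w z|^(-2p)`, bounded uniformly in
`w` by a scaling argument (`exists_lintegral_kernel_le`).

Necessity. Only `f = 1` and real `w = r` are needed: near `r` the derivative of `C_μ 1` is at least
a multiple of `r μ([r,1))/(1 - r)^2`, and the `Q_p` integral over a disk of radius comparable to `1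
- r` then bounds `μ([r,1))/(1 - r)` for `r ≥ 1/2`. -/

theorem mem_unitDisk_iff {z : ℂ} : z ∈ unitDisk ↔ ‖z‖ < 1 := by simp [unitDisk]

theorem isOpen_unitDisk : IsOpen unitDisk := isOpen_ball

/-! ### The kernel `f(tz)/(1 - tz)`: derivative, size and power series. -/

section Kernel

variable {t : ℝ} {z : ℂ}

theorem norm_ofReal_mul_of_nonneg (ht : 0 ≤ t) : ‖(t : ℂ) * z‖ = t * ‖z‖ := by
  rw [norm_mul, Complex.norm_of_nonneg ht]

theorem mul_norm_lt_one (ht0 : 0 ≤ t) (ht1 : t < 1) (hz : ‖z‖ < 1) : t * ‖z‖ < 1 := by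
  nlinarith [norm_nonneg z]

theorem one_sub_mul_norm_le (ht : 0 ≤ t) : 1 - t * ‖z‖ ≤ ‖1 - (t : ℂ) * z‖ := by
  have h := norm_sub_norm_le (1 : ℂ) ((t : ℂ) * z)
  rwa [norm_one, norm_ofReal_mul_of_nonneg ht] at h

theorem one_sub_ofReal_mul_ne_zero (ht0 : 0 ≤ t) (ht1 : t < 1) (hz : ‖z‖ < 1) :
    1 - (t : ℂ) * z ≠ 0 := by
  have h1 := one_sub_mul_norm_le (z := z) ht0
  have h2 := mul_norm_lt_one ht0 ht1 hz
  exact norm_pos_iff.mp (by linarith)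

theorem ofReal_mul_mem_unitDisk (ht0 : 0 ≤ t) (ht1 : t < 1) (hz : ‖z‖ < 1) :
    (t : ℂ) * z ∈ unitDisk := by
  rw [mem_unitDisk_iff, norm_ofReal_mul_of_nonneg ht0]
  exact mul_norm_lt_one ht0 ht1 hz

/-- The derivative in `z` of `f (t z) / (1 - t z)`. -/
noncomputable def cesaroKernelDeriv (f : ℂ → ℂ) (t : ℝ) (z : ℂ) : ℂ :=
  t * deriv f (t * z) / (1 - t * z) + t * f (t * z) / (1 - t * z) ^ 2

theorem hasDerivAt_cesaroKernel {f : ℂ → ℂ} (hf : f ∈ analyticDisk)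
    (ht0 : 0 ≤ t) (ht1 : t < 1) (hz : ‖z‖ < 1) :
    HasDerivAt (fun z : ℂ => f (t * z) / (1 - t * z)) (cesaroKernelDeriv f t z) z := by
  have hne := one_sub_ofReal_mul_ne_zero ht0 ht1 hz
  have hd : HasDerivAt f (deriv f (t * z)) (t * z) :=
    (hf.differentiableAt
      (isOpen_unitDisk.mem_nhds (ofReal_mul_mem_unitDisk ht0 ht1 hz))).hasDerivAt
  have hl : HasDerivAt (fun z : ℂ => (t : ℂ) * z) t z := by
    simpa using (hasDerivAt_id z).const_mul (t : ℂ)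
  refine ((hd.comp z hl).div (hl.const_sub 1) hne).congr_deriv ?_
  simp only [cesaroKernelDeriv, Function.comp_apply]
  field_simp
  ring

/-- A Cauchy-type estimate on the largest disk about `z` inside `𝔻`; there `f` stays within `2M` of
`f z`. -/
theorem norm_deriv_le_of_bounded {f : ℂ → ℂ} {M : ℝ} (hf : f ∈ analyticDisk)
    (hM : ∀ z ∈ unitDisk, ‖f z‖ ≤ M) (hz : ‖z‖ < 1) : ‖deriv f z‖ ≤ 2 * M / (1 - ‖z‖) := by
  have hsub : ball z (1 - ‖z‖) ⊆ unitDisk := fun y hy => by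
    rw [mem_ball, dist_eq_norm] at hy
    rw [mem_unitDisk_iff]
    have := norm_le_norm_add_norm_sub' y z
    linarith
  refine Complex.norm_deriv_le_div_of_mapsTo_ball (hf.mono hsub) (fun y hy => ?_) (by linarith)
  rw [mem_closedBall, dist_eq_norm]
  have h1 := norm_sub_le (f y) (f z)
  have h2 := hM y (hsub hy)
  have h3 := hM z (mem_unitDisk_iff.mpr hz)
  linarith

/-- The factor `1 - t|z|` comes from the bound on `f'` at `tz` in the first term, and from `|1 - tz|
≥ 1 - t|z|`, applied to one of the two factors, in the second. -/
theorem norm_cesaroKernelDeriv_le {f : ℂ → ℂ} {M : ℝ} (hf : f ∈ analyticDisk)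
    (hM : ∀ z ∈ unitDisk, ‖f z‖ ≤ M) (ht0 : 0 ≤ t) (ht1 : t < 1) (hz : ‖z‖ < 1) :
    ‖cesaroKernelDeriv f t z‖ ≤ 3 * M / ((1 - t * ‖z‖) * ‖1 - (t : ℂ) * z‖) := by
  have hM0 : 0 ≤ M := (norm_nonneg _).trans (hM 0 (by simp [mem_unitDisk_iff]))
  have hD := ofReal_mul_mem_unitDisk ht0 ht1 hz
  have h1 := norm_deriv_le_of_bounded hf hM (mem_unitDisk_iff.mp hD)
  have h2 := hM _ hD
  rw [norm_ofReal_mul_of_nonneg ht0] at h1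
  have ha : 0 < 1 - t * ‖z‖ := by linarith [mul_norm_lt_one ht0 ht1 hz]
  have hb := one_sub_mul_norm_le (z := z) ht0
  have hb0 : 0 < ‖1 - (t : ℂ) * z‖ := ha.trans_le hb
  have e1 : ‖(t : ℂ) * deriv f (t * z) / (1 - t * z)‖
      ≤ 2 * M / ((1 - t * ‖z‖) * ‖1 - (t : ℂ) * z‖) := by
    rw [norm_div, norm_ofReal_mul_of_nonneg ht0, ← div_div]
    gcongr
    calc t * ‖deriv f (t * z)‖ ≤ 1 * ‖deriv f (t * z)‖ := by gcongr
      _ ≤ _ := by rwa [one_mul]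
  have e2 : ‖(t : ℂ) * f (t * z) / (1 - t * z) ^ 2‖
      ≤ M / ((1 - t * ‖z‖) * ‖1 - (t : ℂ) * z‖) := by
    rw [norm_div, norm_ofReal_mul_of_nonneg ht0, norm_pow, sq]
    gcongr
    calc t * ‖f (t * z)‖ ≤ 1 * ‖f (t * z)‖ := by gcongr
      _ ≤ _ := by rwa [one_mul]
  calc _ ≤ _ := norm_add_le _ _
    _ ≤ _ := add_le_add e1 e2
    _ = _ := by ring

/-- Cauchy product of the Taylor series of `f` with the geometric series, both at `tz`. -/
theorem hasSum_cesaroKernel {f : ℂ → ℂ} (hf : f ∈ analyticDisk)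
    (ht0 : 0 ≤ t) (ht1 : t < 1) (hz : ‖z‖ < 1) :
    HasSum (fun n : ℕ =>
        (((t ^ n : ℝ) : ℂ) * ∑ k ∈ Finset.range (n + 1), taylorCoeff f k) * z ^ n)
      (f (t * z) / (1 - t * z)) := by
  have hD := ofReal_mul_mem_unitDisk ht0 ht1 hz
  have hD1 := mem_unitDisk_iff.mp hD
  set w : ℂ := t * z with hw
  have ha : HasSum (fun n : ℕ => taylorCoeff f n * w ^ n) (f w) := by
    have h := Complex.hasSum_taylorSeries_on_ball (c := 0) (r := 1) (f := f)
      (by simpa [analyticDisk, unitDisk] using hf) (z := w) (by simpa [unitDisk] using hD)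
    refine h.congr_fun fun n => ?_
    simp only [taylorCoeff, smul_eq_mul, sub_zero]
    ring
  have hg : HasSum (fun n : ℕ => w ^ n) (1 - w)⁻¹ := hasSum_geometric_of_norm_lt_one hD1
  have hs := summable_norm_sum_mul_antidiagonal_of_summable_norm ha.summable.norm hg.summable.norm
  have he := tsum_mul_tsum_eq_tsum_sum_antidiagonal_of_summable_norm ha.summable.norm
    hg.summable.norm
  rw [ha.tsum_eq, hg.tsum_eq, ← div_eq_mul_inv] at he
  rw [he]
  refine hs.of_norm.hasSum.congr_fun fun n => ?_
  rw [Finset.Nat.sum_antidiagonal_eq_sum_range_succ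
      (fun i j => (taylorCoeff f i * w ^ i) * w ^ j)]
  rw [mul_right_comm, Complex.ofReal_pow, ← mul_pow, ← hw, Finset.mul_sum]
  refine Finset.sum_congr rfl fun k hk => ?_
  rw [mul_assoc, ← pow_add, Nat.add_sub_cancel' (Nat.lt_succ_iff.mp (Finset.mem_range.mp hk)),
    mul_comm]

end Kernel

/-! ### Integral representation and differentiation under the integral sign. -/

section Integral

variable {μ : Measure (Set.Ico (0 : ℝ) 1)} [IsFiniteMeasure μ] {f : ℂ → ℂ} {z : ℂ}

theorem cesaroLike_eq_integral (hf : f ∈ analyticDisk) (hz : ‖z‖ < 1) :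
    cesaroLike μ f z = ∫ t, f ((t : ℝ) * z) / (1 - (t : ℝ) * z) ∂μ := by
  set c : ℕ → ℂ := fun n => (∑ k ∈ Finset.range (n + 1), taylorCoeff f k) * z ^ n with hc
  have hint : ∀ n : ℕ, Integrable (fun t : Set.Ico (0 : ℝ) 1 => (((t : ℝ) ^ n : ℝ) : ℂ)) μ := by
    intro n
    refine Integrable.of_bound (by fun_prop) 1 (Filter.Eventually.of_forall fun t => ?_)
    rw [Complex.norm_real, norm_pow, Real.norm_of_nonneg t.2.1]
    exact pow_le_one₀ t.2.1 t.2.2.le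
  -- Since the moments are nonnegative, these integrals are exactly the terms of the absolutely
  -- convergent defining series, so sum and integral may be exchanged.
  have hm : ∀ n : ℕ, ∫ t : Set.Ico (0 : ℝ) 1, ‖(((t : ℝ) ^ n : ℝ) : ℂ) * c n‖ ∂μ
      = ‖((moment01 μ n : ℂ) * ∑ k ∈ Finset.range (n + 1), taylorCoeff f k) * z ^ n‖ := by
    intro n
    have h0 : 0 ≤ moment01 μ n := integral_nonneg fun t => pow_nonneg t.2.1 n
    rw [mul_assoc, norm_mul, Complex.norm_of_nonneg h0, moment01, ← integral_mul_const]
    refine integral_congr_ae (Filter.Eventually.of_forall fun t => ?_)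
    simp only [hc]
    rw [norm_mul, Complex.norm_of_nonneg (pow_nonneg t.2.1 n)]
  have hsum := hasSum_integral_of_summable_integral_norm (μ := μ)
    (F := fun n (t : Set.Ico (0 : ℝ) 1) => (((t : ℝ) ^ n : ℝ) : ℂ) * c n)
    (fun n => (hint n).mul_const _)
    (by simpa only [hm] using summable_cesaroLike μ hf (mem_unitDisk_iff.mpr hz))
  have hk : ∀ t : Set.Ico (0 : ℝ) 1, ∑' n, (((t : ℝ) ^ n : ℝ) : ℂ) * c n
      = f ((t : ℝ) * z) / (1 - (t : ℝ) * z) := fun t => by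
    rw [← (hasSum_cesaroKernel hf t.2.1 t.2.2 hz).tsum_eq]
    simp only [hc, mul_assoc]
  simp only [hk] at hsum
  rw [← hsum.tsum_eq, cesaroLike]
  refine tsum_congr fun n => ?_
  rw [integral_mul_const, integral_complex_ofReal, ← moment01, mul_assoc]

theorem continuous_comp_ofReal_mul {g : ℂ → ℂ} (hg : ContinuousOn g unitDisk) (hz : ‖z‖ < 1) :
    Continuous fun t : Set.Ico (0 : ℝ) 1 => g ((t : ℝ) * z) :=
  hg.comp_continuous (by fun_prop) fun t => ofReal_mul_mem_unitDisk t.2.1 t.2.2 hz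

theorem continuous_cesaroKernel (hf : f ∈ analyticDisk) (hz : ‖z‖ < 1) :
    Continuous fun t : Set.Ico (0 : ℝ) 1 => f ((t : ℝ) * z) / (1 - (t : ℝ) * z) :=
  (continuous_comp_ofReal_mul hf.continuousOn hz).div (by fun_prop)
    fun t => one_sub_ofReal_mul_ne_zero t.2.1 t.2.2 hz

theorem continuous_cesaroKernelDeriv (hf : f ∈ analyticDisk) (hz : ‖z‖ < 1) :
    Continuous fun t : Set.Ico (0 : ℝ) 1 => cesaroKernelDeriv f t z := by
  have h1 := continuous_comp_ofReal_mul hf.continuousOn hz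
  have h2 := continuous_comp_ofReal_mul (hf.deriv isOpen_unitDisk).continuousOn hz
  have h3 : ∀ t : Set.Ico (0 : ℝ) 1, 1 - ((t : ℝ) : ℂ) * z ≠ 0 :=
    fun t => one_sub_ofReal_mul_ne_zero t.2.1 t.2.2 hz
  have h4 : Continuous fun t : Set.Ico (0 : ℝ) 1 => ((t : ℝ) : ℂ) := by fun_prop
  have h5 : Continuous fun t : Set.Ico (0 : ℝ) 1 => 1 - ((t : ℝ) : ℂ) * z := by fun_prop
  exact ((h4.mul h2).div h5 h3).add ((h4.mul h1).div (h5.pow 2) fun t => pow_ne_zero 2 (h3 t))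

theorem hasDerivAt_cesaroLike (hf : f ∈ hardyInfty) (hz : ‖z‖ < 1) :
    Integrable (fun t : Set.Ico (0 : ℝ) 1 => cesaroKernelDeriv f t z) μ ∧
    HasDerivAt (cesaroLike μ f) (∫ t : Set.Ico (0 : ℝ) 1, cesaroKernelDeriv f t z ∂μ) z := by
  obtain ⟨hf, M, hM⟩ := hf
  have hM0 : 0 ≤ M := (norm_nonneg _).trans (hM 0 (by simp [mem_unitDisk_iff]))
  -- A radius strictly between `‖z‖` and `1`: on the ball of radius `r` the kernel derivative has a
  -- bound independent of `t`.
  set r : ℝ := (1 + ‖z‖) / 2 with hr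
  have hr1 : r < 1 := by rw [hr]; linarith
  have hs : ball (0 : ℂ) r ∈ nhds z :=
    isOpen_ball.mem_nhds (by rw [mem_ball_zero_iff, hr]; linarith)
  have hlt : ∀ x ∈ ball (0 : ℂ) r, ‖x‖ < 1 := fun x hx => by
    rw [mem_ball_zero_iff] at hx; linarith
  have hcont := continuous_cesaroKernel hf hz
  have hbd : ∀ t : Set.Ico (0 : ℝ) 1, ‖f ((t : ℝ) * z) / (1 - (t : ℝ) * z)‖ ≤ M / (1 - r) := by
    intro t
    have h1 := one_sub_mul_norm_le (z := z) t.2.1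
    have h2 : (t : ℝ) * ‖z‖ ≤ 1 * ‖z‖ := by gcongr; exact t.2.2.le
    rw [norm_div]
    have h3 : 1 - r ≤ ‖1 - ((t : ℝ) : ℂ) * z‖ := by rw [hr]; linarith
    have h4 := hM _ (ofReal_mul_mem_unitDisk t.2.1 t.2.2 hz)
    have h5 : 0 < 1 - r := by linarith
    gcongr
  have hmain := hasDerivAt_integral_of_dominated_loc_of_deriv_le (μ := μ) (𝕜 := ℂ)
    (F := fun z (t : Set.Ico (0 : ℝ) 1) => f ((t : ℝ) * z) / (1 - (t : ℝ) * z))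
    (F' := fun z (t : Set.Ico (0 : ℝ) 1) => cesaroKernelDeriv f t z) (x₀ := z)
    (bound := fun _ => 3 * M / ((1 - r) * (1 - r))) hs
    (Filter.eventually_of_mem hs fun x hx =>
      (continuous_cesaroKernel hf (hlt x hx)).aestronglyMeasurable)
    (Integrable.of_bound hcont.aestronglyMeasurable _ (Filter.Eventually.of_forall hbd))
    (continuous_cesaroKernelDeriv hf hz).aestronglyMeasurable
    (Filter.Eventually.of_forall fun t x hx => by
      refine (norm_cesaroKernelDeriv_le hf hM t.2.1 t.2.2 (hlt x hx)).trans ?_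
      have h1 := one_sub_mul_norm_le (z := x) t.2.1
      have h2 : (t : ℝ) * ‖x‖ ≤ 1 * ‖x‖ := by gcongr; exact t.2.2.le
      rw [mem_ball_zero_iff] at hx
      have h3 : 1 - r ≤ 1 - t * ‖x‖ := by linarith
      have h4 : 0 < 1 - r := by linarith
      have h5 := h3.trans h1
      have h6 := h4.le.trans h3
      gcongr)
    (integrable_const _)
    (Filter.Eventually.of_forall fun t x hx =>
      hasDerivAt_cesaroKernel hf t.2.1 t.2.2 (hlt x hx))
  refine ⟨hmain.1, hmain.2.congr_of_eventuallyEq ?_⟩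
  filter_upwards [hs] with x hx using cesaroLike_eq_integral hf (hlt x hx)

theorem cesaroLike_mem_analyticDisk (hf : f ∈ hardyInfty) : cesaroLike μ f ∈ analyticDisk :=
  fun _ hz => (hasDerivAt_cesaroLike hf
    (mem_unitDisk_iff.mp hz)).2.differentiableAt.differentiableWithinAt

end Integral

/-! ### Pointwise bound on the derivative from the Carleson condition. -/

section CarlesonIntegral

variable {μ : Measure (Set.Ico (0 : ℝ) 1)} {C ε h : ℝ}

theorem measure_one_sub_le_of_carleson (hC : 0 < C)
    (hμ : ∀ t : Set.Ico (0 : ℝ) 1, μ (Set.Ici t) ≤ ENNReal.ofReal (C * (1 - t))) (x : ℝ) :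
    μ {t | 1 - (t : ℝ) ≤ x} ≤ ENNReal.ofReal (C * x) := by
  rcases le_or_gt x 0 with hx | hx
  · have : {t : Set.Ico (0 : ℝ) 1 | 1 - (t : ℝ) ≤ x} = ∅ :=
      Set.eq_empty_of_forall_notMem fun t ht => by
        have := t.2.2
        simp only [Set.mem_ofPred_eq] at ht
        linarith
    rw [this, measure_empty]
    exact zero_le
  · have hs : max 0 (1 - x) ∈ Set.Ico (0 : ℝ) 1 :=
      ⟨le_max_left _ _, max_lt one_pos (by linarith)⟩
    calc μ {t | 1 - (t : ℝ) ≤ x} ≤ μ (Set.Ici ⟨max 0 (1 - x), hs⟩) := by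
          refine measure_mono fun t ht => ?_
          simp only [Set.mem_ofPred_eq] at ht
          exact show max 0 (1 - x) ≤ (t : ℝ) from max_le t.2.1 (by linarith)
      _ ≤ _ := hμ _
      _ ≤ _ := by
          refine ENNReal.ofReal_le_ofReal (mul_le_mul_of_nonneg_left ?_ hC.le)
          have := le_max_right 0 (1 - x)
          simp only
          linarith

/-- Layer-cake formula: the superlevel set at height `s` is `{1 - t ≤ 1/s - h}`, which is empty for
`s > 1/h` and otherwise has measure at most `C/s`. This leaves `∫ C s^(ε-1)` over `(0, 1/h]`. -/
theorem lintegral_rpow_le_of_carleson (hC : 0 < C)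
    (hμ : ∀ t : Set.Ico (0 : ℝ) 1, μ (Set.Ici t) ≤ ENNReal.ofReal (C * (1 - t)))
    (hε : 0 < ε) (hh : 0 < h) :
    ∫⁻ t : Set.Ico (0 : ℝ) 1, ENNReal.ofReal ((1 - (t : ℝ) + h)⁻¹ ^ (1 + ε)) ∂μ
      ≤ ENNReal.ofReal ((1 + ε) * (C * (h⁻¹ ^ ε / ε))) := by
  have hpos : ∀ t : Set.Ico (0 : ℝ) 1, 0 < 1 - (t : ℝ) + h := fun t => by linarith [t.2.2]
  rw [lintegral_rpow_eq_lintegral_meas_le_mul μ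
    (Filter.Eventually.of_forall fun t => (inv_pos.mpr (hpos t)).le)
    (by fun_prop) (by linarith), ENNReal.ofReal_mul (by linarith)]
  gcongr
  have hint : IntervalIntegrable (fun s : ℝ => C * s ^ (ε - 1)) volume 0 h⁻¹ :=
    (intervalIntegral.intervalIntegrable_rpow' (by linarith)).const_mul C
  calc ∫⁻ s in Set.Ioi 0, μ {t : Set.Ico (0 : ℝ) 1 | s ≤ (1 - (t : ℝ) + h)⁻¹}
          * ENNReal.ofReal (s ^ (1 + ε - 1))
      ≤ ∫⁻ s in Set.Ioi 0,
          (Set.Ioc 0 h⁻¹).indicator (fun s => ENNReal.ofReal (C * s ^ (ε - 1))) s := by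
        refine setLIntegral_mono' measurableSet_Ioi fun s hs => ?_
        have hs0 : 0 < s := hs
        have heq : {t : Set.Ico (0 : ℝ) 1 | s ≤ (1 - (t : ℝ) + h)⁻¹}
            = {t : Set.Ico (0 : ℝ) 1 | 1 - (t : ℝ) ≤ s⁻¹ - h} := by
          ext t
          simp only [Set.mem_ofPred_eq]
          rw [le_inv_comm₀ hs0 (hpos t), le_sub_iff_add_le]
        rw [heq]
        have hm := measure_one_sub_le_of_carleson hC hμ (s⁻¹ - h)
        by_cases hsh : s ≤ h⁻¹
        · rw [Set.indicator_of_mem (show s ∈ Set.Ioc 0 h⁻¹ from ⟨hs0, hsh⟩)]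
          calc _ ≤ ENNReal.ofReal (C * s⁻¹) * ENNReal.ofReal (s ^ (1 + ε - 1)) := by
                gcongr
                refine hm.trans (ENNReal.ofReal_le_ofReal ?_)
                gcongr
                linarith
            _ = _ := by
                rw [← ENNReal.ofReal_mul (by positivity), add_sub_cancel_left,
                  Real.rpow_sub_one hs0.ne']
                congr 1
                ring
        · have : s⁻¹ - h ≤ 0 := by
            have := (inv_lt_comm₀ hh hs0).mp (not_le.mp hsh)
            linarith
          rw [ENNReal.ofReal_of_nonpos (mul_nonpos_of_nonneg_of_nonpos hC.le this)] at hm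
          rw [nonpos_iff_eq_zero.mp hm, zero_mul]
          exact zero_le
    _ = ∫⁻ s in Set.Ioc 0 h⁻¹, ENNReal.ofReal (C * s ^ (ε - 1)) := by
        rw [lintegral_indicator measurableSet_Ioc, Measure.restrict_restrict measurableSet_Ioc,
          Set.inter_eq_left.mpr Set.Ioc_subset_Ioi_self]
    _ = ENNReal.ofReal (∫ s in Set.Ioc 0 h⁻¹, C * s ^ (ε - 1)) := by
        rw [ofReal_integral_eq_lintegral_ofReal
          ((intervalIntegrable_iff_integrableOn_Ioc_of_le (inv_pos.mpr hh).le).mp hint)]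
        refine (ae_restrict_iff' measurableSet_Ioc).mpr (Filter.Eventually.of_forall fun s hs => ?_)
        have := hs.1
        simp only [Pi.zero_apply]
        positivity
    _ = _ := by
        rw [← intervalIntegral.integral_of_le (inv_pos.mpr hh).le,
          intervalIntegral.integral_const_mul, integral_rpow (Or.inl (by linarith)),
          sub_add_cancel, Real.zero_rpow hε.ne', sub_zero]

/-- With `s = (1 - t) + (1 - |z|)`, one has `s ≤ 2(1 - t|z|)`, while `|1 - tz|` dominates both `|1 -
z|/2` and `s/2`. Splitting `|1 - tz|` into powers `1 - ε` and `ε` uses both bounds. -/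
theorem rpow_mul_rpow_le_kernel {t : ℝ} {z : ℂ} (hε0 : 0 < ε) (hε1 : ε < 1) (ht0 : 0 ≤ t)
    (ht1 : t < 1) (hz : ‖z‖ < 1) :
    ‖1 - z‖ ^ (1 - ε) * (1 - t + (1 - ‖z‖)) ^ (1 + ε)
      ≤ 4 * ((1 - t * ‖z‖) * ‖1 - (t : ℂ) * z‖) := by
  set u := ‖1 - (t : ℂ) * z‖
  set s := 1 - t + (1 - ‖z‖) with hs
  have hn := norm_nonneg z
  have h1 : 1 - t * ‖z‖ ≤ u := one_sub_mul_norm_le ht0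
  have h2 : s ≤ 2 * (1 - t * ‖z‖) := by nlinarith
  have hs0 : 0 < s := by linarith
  have h3 : ‖1 - z‖ ≤ 2 * u := by
    have e : (1 : ℂ) - z = (1 - t * z) - ((1 - t : ℝ) : ℂ) * z := by push_cast; ring
    have h := norm_sub_le (1 - (t : ℂ) * z) (((1 - t : ℝ) : ℂ) * z)
    rw [← e, norm_ofReal_mul_of_nonneg (by linarith)] at h
    have : (1 - t) * ‖z‖ ≤ 1 - t * ‖z‖ := by nlinarith
    linarith
  calc ‖1 - z‖ ^ (1 - ε) * s ^ (1 + ε) = ‖1 - z‖ ^ (1 - ε) * s ^ ε * s := by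
        rw [add_comm, Real.rpow_add_one hs0.ne']; ring
    _ ≤ (2 * u) ^ (1 - ε) * (2 * u) ^ ε * (2 * (1 - t * ‖z‖)) := by
        have : 0 ≤ 1 - ε := by linarith
        gcongr
        linarith
    _ = 4 * ((1 - t * ‖z‖) * u) := by
        rw [← Real.rpow_add (by linarith), sub_add_cancel, Real.rpow_one]; ring

theorem exists_norm_deriv_cesaroLike_le [IsFiniteMeasure μ] (hμ : IsCarleson01 μ) {f : ℂ → ℂ}
    (hf : f ∈ hardyInfty) (hε0 : 0 < ε) (hε1 : ε < 1) :
    ∃ K : ℝ, 0 ≤ K ∧ ∀ z : ℂ, ‖z‖ < 1 →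
      ‖deriv (cesaroLike μ f) z‖ ≤ K * (‖1 - z‖ ^ (ε - 1) * (1 - ‖z‖) ^ (-ε)) := by
  obtain ⟨C, hC, hμ⟩ := hμ
  obtain ⟨M, hM⟩ := hf.2
  have hM0 : 0 ≤ M := (norm_nonneg _).trans (hM 0 (by simp [mem_unitDisk_iff]))
  refine ⟨12 * M * ((1 + ε) * (C / ε)), by positivity, fun z hz => ?_⟩
  have hh : 0 < 1 - ‖z‖ := by linarith
  have hz1 : 0 < ‖1 - z‖ := by
    refine norm_pos_iff.mpr (sub_ne_zero.mpr ?_)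
    rintro rfl
    simp at hz
  rw [(hasDerivAt_cesaroLike (μ := μ) hf hz).2.deriv]
  -- Working in `ℝ≥0∞` avoids any integrability check for the majorant.
  rw [← ENNReal.ofReal_le_ofReal_iff (by positivity), ofReal_norm]
  calc _ ≤ ∫⁻ t : Set.Ico (0 : ℝ) 1, ‖cesaroKernelDeriv f t z‖ₑ ∂μ :=
        enorm_integral_le_lintegral_enorm _
    _ ≤ ∫⁻ t : Set.Ico (0 : ℝ) 1, ENNReal.ofReal (12 * M * ‖1 - z‖ ^ (ε - 1))
          * ENNReal.ofReal ((1 - (t : ℝ) + (1 - ‖z‖))⁻¹ ^ (1 + ε)) ∂μ := by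
        refine lintegral_mono fun t => ?_
        have hs : 0 < 1 - (t : ℝ) + (1 - ‖z‖) := by linarith [t.2.2]
        rw [← ENNReal.ofReal_mul (by positivity), ← ofReal_norm]
        refine ENNReal.ofReal_le_ofReal
          ((norm_cesaroKernelDeriv_le hf.1 hM t.2.1 t.2.2 hz).trans ?_)
        have hk := rpow_mul_rpow_le_kernel hε0 hε1 t.2.1 t.2.2 hz
        calc _ = 12 * M / (4 * ((1 - t * ‖z‖) * ‖1 - ((t : ℝ) : ℂ) * z‖)) := by
              rw [show 12 * M = 4 * (3 * M) by ring, mul_div_mul_left _ _ four_ne_zero]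
          _ ≤ 12 * M / (‖1 - z‖ ^ (1 - ε) * (1 - (t : ℝ) + (1 - ‖z‖)) ^ (1 + ε)) := by
              gcongr
          _ = _ := by
              rw [Real.inv_rpow hs.le, ← neg_sub 1 ε, Real.rpow_neg hz1.le]
              field_simp
    _ ≤ ENNReal.ofReal (12 * M * ‖1 - z‖ ^ (ε - 1))
          * ENNReal.ofReal ((1 + ε) * (C * ((1 - ‖z‖)⁻¹ ^ ε / ε))) := by
        rw [lintegral_const_mul' _ _ ENNReal.ofReal_ne_top]
        gcongr
        exact lintegral_rpow_le_of_carleson hC hμ hε0 hh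
    _ = _ := by
        rw [← ENNReal.ofReal_mul (by positivity), Real.inv_rpow hh.le, ← Real.rpow_neg hh.le]
        congr 1
        ring

end CarlesonIntegral

/-! ### A planar integral bounded uniformly in `w`. -/

section Radial

/-- The radial profile `x ^ (p - 2) * max 1 x ^ (-2 p)`, integrable over the plane. -/
noncomputable def radialProfile (p x : ℝ) : ℝ := x ^ (p - 2) * max 1 x ^ (-(2 * p))

variable {p : ℝ}

theorem measurable_radialProfile : Measurable (radialProfile p) := by
  unfold radialProfile
  fun_prop

/-- In polar coordinates the integrand is `y^(p-1)` on `(0,1]` and `y^(-p-1)` beyond. -/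
theorem lintegral_radialProfile_lt_top (hp : 0 < p) :
    ∫⁻ z : ℂ, ENNReal.ofReal (radialProfile p ‖z‖) < ∞ := by
  have h : Integrable (fun z : ℂ => radialProfile p ‖z‖) := by
    rw [integrable_fun_norm_addHaar (volume : Measure ℂ) (f := radialProfile p),
      Complex.finrank_real_complex, ← Set.Ioc_union_Ioi_eq_Ioi zero_le_one]
    refine IntegrableOn.union ?_ ?_
    · have h1 : IntegrableOn (fun y : ℝ => y ^ (p - 1)) (Set.Ioc 0 1) :=
        (intervalIntegrable_iff_integrableOn_Ioc_of_le zero_le_one).mp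
          (intervalIntegral.intervalIntegrable_rpow' (by linarith))
      refine h1.congr_fun (fun y hy => ?_) measurableSet_Ioc
      have hy0 : 0 < y := hy.1
      simp only [radialProfile, smul_eq_mul, max_eq_left hy.2, Real.one_rpow, mul_one]
      rw [show p - 1 = p - 2 + 1 by ring, Real.rpow_add_one hy0.ne']
      ring
    · have h1 : IntegrableOn (fun y : ℝ => y ^ (-p - 1)) (Set.Ioi 1) :=
        integrableOn_Ioi_rpow_of_lt (by linarith) one_pos
      refine h1.congr_fun (fun y hy => ?_) measurableSet_Ioi
      have hy1 : 1 < y := hy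
      have hy0 : 0 < y := by linarith
      simp only [radialProfile, smul_eq_mul, max_eq_right hy1.le]
      rw [← Real.rpow_add hy0, show -p - 1 = p - 2 + -(2 * p) + 1 by ring,
        Real.rpow_add_one hy0.ne']
      ring
  exact h.lintegral_lt_top

theorem lintegral_comp_mul_norm {g : ℝ → ℝ≥0∞} (hg : Measurable g) {a : ℝ} (ha : 0 < a) :
    ∫⁻ z : ℂ, g (a * ‖z‖) = ENNReal.ofReal (a ^ 2)⁻¹ * ∫⁻ z : ℂ, g ‖z‖ := by
  have h := Measure.map_addHaar_smul (volume : Measure ℂ) ha.ne'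
  rw [Complex.finrank_real_complex, abs_of_pos (by positivity)] at h
  rw [← smul_eq_mul, ← lintegral_smul_measure, ← h, lintegral_map (by fun_prop) (by fun_prop)]
  simp only [norm_smul, Real.norm_of_nonneg ha.le]

/-- The dilation of `radialProfile p` by `d`, normalized to have the same planar integral. -/
noncomputable def dilatedProfile (p d x : ℝ) : ℝ := d ^ p * x ^ (p - 2) * max d x ^ (-(2 * p))

theorem dilatedProfile_eq {d x : ℝ} (hd : 0 < d) (hx : 0 ≤ x) :
    dilatedProfile p d x = (d ^ 2)⁻¹ * radialProfile p (d⁻¹ * x) := by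
  have hm : max d x = d * max 1 (d⁻¹ * x) := by
    rw [mul_max_of_nonneg _ _ hd.le, mul_one, mul_inv_cancel_left₀ hd.ne']
  have h1 : (0 : ℝ) ≤ max 1 (d⁻¹ * x) := by positivity
  have h2 : d ^ (2 : ℝ) = d ^ 2 := by norm_cast
  have h3 : d ^ (p * 2) = d ^ p * d ^ p := by rw [mul_two, Real.rpow_add hd]
  have hp : 0 < d ^ p := by positivity
  rw [dilatedProfile, radialProfile, hm, Real.mul_rpow hd.le h1,
    Real.mul_rpow (by positivity) hx, Real.inv_rpow hd.le, Real.rpow_sub hd, h2,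
    Real.rpow_neg hd.le, mul_comm 2 p, h3]
  field_simp

/-- The right side does not involve `d`; this is the source of uniformity in `w`, with `d = 1 -
|w|`. -/
theorem lintegral_dilatedProfile {d : ℝ} (hd : 0 < d) {c : ℂ} (hc : c ≠ 0) (b : ℂ) :
    ∫⁻ z : ℂ, ENNReal.ofReal (dilatedProfile p d ‖c * (z - b)‖)
      = ENNReal.ofReal (‖c‖ ^ 2)⁻¹ * ∫⁻ z : ℂ, ENNReal.ofReal (radialProfile p ‖z‖) := by
  have hc0 : 0 < ‖c‖ := norm_pos_iff.mpr hc
  have hg : Measurable fun x : ℝ => ENNReal.ofReal ((d ^ 2)⁻¹ * radialProfile p x) :=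
    (measurable_radialProfile.const_mul _).ennreal_ofReal
  calc _ = ∫⁻ z : ℂ, ENNReal.ofReal ((d ^ 2)⁻¹ * radialProfile p ((d⁻¹ * ‖c‖) * ‖z - b‖)) := by
        refine lintegral_congr fun z => ?_
        rw [dilatedProfile_eq hd (norm_nonneg _), norm_mul, mul_assoc]
    _ = ∫⁻ z : ℂ, ENNReal.ofReal ((d ^ 2)⁻¹ * radialProfile p ((d⁻¹ * ‖c‖) * ‖z‖)) :=
        lintegral_sub_right_eq_self
          (fun z : ℂ => ENNReal.ofReal ((d ^ 2)⁻¹ * radialProfile p ((d⁻¹ * ‖c‖) * ‖z‖))) b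
    _ = ENNReal.ofReal ((d⁻¹ * ‖c‖) ^ 2)⁻¹
          * ∫⁻ z : ℂ, ENNReal.ofReal ((d ^ 2)⁻¹ * radialProfile p ‖z‖) :=
        lintegral_comp_mul_norm hg (by positivity)
    _ = _ := by
        simp_rw [ENNReal.ofReal_mul (show (0 : ℝ) ≤ (d ^ 2)⁻¹ by positivity)]
        rw [lintegral_const_mul' _ _ ENNReal.ofReal_ne_top, ← mul_assoc,
          ← ENNReal.ofReal_mul (by positivity)]
        congr 2
        field_simp

theorem dilatedProfile_nonneg {d x : ℝ} (hd : 0 ≤ d) (hx : 0 ≤ x) : 0 ≤ dilatedProfile p d x := by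
  unfold dilatedProfile
  positivity

/-- The smaller of `x` and `y` carries the estimate: if `x ≤ y`, then `max d x ≤ y` and the power
`-2p` decreases; if `y ≤ x`, the power `p - 2 < 0` lets `y` replace `x`. -/
theorem rpow_mul_rpow_le_dilatedProfile_add (hp0 : 0 < p) (hp2 : p < 2) {d x y : ℝ}
    (hd : 0 < d) (hx : 0 < x) (hy : d ≤ y) :
    d ^ p * x ^ (p - 2) * y ^ (-(2 * p)) ≤ dilatedProfile p d x + dilatedProfile p d y := by
  have hy0 := hd.trans_le hy
  rcases le_total x y with h | h
  · refine le_add_of_le_of_nonneg ?_ (dilatedProfile_nonneg hd.le hy0.le)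
    refine mul_le_mul_of_nonneg_left ?_ (by positivity)
    exact Real.rpow_le_rpow_of_nonpos (by positivity) (max_le hy h) (by linarith)
  · refine le_add_of_nonneg_of_le (dilatedProfile_nonneg hd.le hx.le) ?_
    rw [dilatedProfile, max_eq_right hy]
    have := Real.rpow_le_rpow_of_nonpos hy0 h (show p - 2 ≤ 0 by linarith)
    gcongr

theorem dilatedProfile_le_of_half_le (hp0 : 0 < p) {d x : ℝ} (hd0 : 0 < d) (hd1 : d ≤ 1)
    (hdx : d ≤ x) (hx : 1 / 2 ≤ x) : dilatedProfile p d x ≤ (1 / 2) ^ (-p - 2) := by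
  have hx0 := hd0.trans_le hdx
  rw [dilatedProfile, max_eq_right hdx, mul_assoc, ← Real.rpow_add hx0,
    show p - 2 + -(2 * p) = -p - 2 by ring]
  calc _ ≤ 1 * x ^ (-p - 2) := by
        gcongr
        exact Real.rpow_le_one hd0.le hd1 hp0.le
    _ ≤ _ := by
        rw [one_mul]
        exact Real.rpow_le_rpow_of_nonpos (by norm_num) hx (by linarith)

theorem one_sub_norm_le_norm_one_sub_conj_mul {w z : ℂ} (hz : ‖z‖ < 1) :
    1 - ‖w‖ ≤ ‖1 - conj w * z‖ := by
  have h := norm_sub_norm_le (1 : ℂ) (conj w * z)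
  rw [norm_one, norm_mul, RCLike.norm_conj] at h
  nlinarith [norm_nonneg w]

/-- The integrand splits into two dilated profiles with singular centres `1` and `1/conj w`. -/
theorem exists_lintegral_kernel_le (hp0 : 0 < p) (hp2 : p < 2) :
    ∃ K : ℝ≥0∞, K < ∞ ∧ ∀ w : ℂ, ‖w‖ < 1 →
      ∫⁻ z in unitDisk, ENNReal.ofReal
        ((1 - ‖w‖) ^ p * ‖1 - z‖ ^ (p - 2) * ‖1 - conj w * z‖ ^ (-(2 * p))) ≤ K := by
  set J := ∫⁻ z : ℂ, ENNReal.ofReal (radialProfile p ‖z‖) with hJ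
  have hJt : J < ∞ := lintegral_radialProfile_lt_top hp0
  have hvol : volume unitDisk < ∞ := measure_ball_lt_top
  refine ⟨J + (ENNReal.ofReal ((1 / 2) ^ (-p - 2)) * volume unitDisk + ENNReal.ofReal 4 * J),
    ENNReal.add_lt_top.mpr ⟨hJt, ENNReal.add_lt_top.mpr
      ⟨ENNReal.mul_lt_top ENNReal.ofReal_lt_top hvol,
        ENNReal.mul_lt_top ENNReal.ofReal_lt_top hJt⟩⟩, fun w hw => ?_⟩
  have hd : 0 < 1 - ‖w‖ := by linarith
  have hmeas : Measurable fun z : ℂ => ENNReal.ofReal (dilatedProfile p (1 - ‖w‖) ‖1 * (z - 1)‖) := by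
    unfold dilatedProfile
    fun_prop
  calc _ ≤ ∫⁻ z in unitDisk, (ENNReal.ofReal (dilatedProfile p (1 - ‖w‖) ‖1 * (z - 1)‖)
          + ENNReal.ofReal (dilatedProfile p (1 - ‖w‖) ‖1 - conj w * z‖)) := by
        refine setLIntegral_mono' isOpen_unitDisk.measurableSet fun z hz => ?_
        rw [mem_unitDisk_iff] at hz
        have hz1 : 0 < ‖1 - z‖ := by
          refine norm_pos_iff.mpr (sub_ne_zero.mpr ?_)
          rintro rfl
          simp at hz
        rw [one_mul, norm_sub_rev z 1, ← ENNReal.ofReal_add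
          (dilatedProfile_nonneg hd.le (norm_nonneg _)) (dilatedProfile_nonneg hd.le (norm_nonneg _))]
        exact ENNReal.ofReal_le_ofReal (rpow_mul_rpow_le_dilatedProfile_add hp0 hp2 hd hz1
          (one_sub_norm_le_norm_one_sub_conj_mul hz))
    _ = (∫⁻ z in unitDisk, ENNReal.ofReal (dilatedProfile p (1 - ‖w‖) ‖1 * (z - 1)‖))
          + ∫⁻ z in unitDisk, ENNReal.ofReal (dilatedProfile p (1 - ‖w‖) ‖1 - conj w * z‖) :=
        lintegral_add_left hmeas _
    _ ≤ _ := by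
        refine add_le_add ((setLIntegral_le_lintegral _ _).trans ?_) ?_
        · rw [lintegral_dilatedProfile hd one_ne_zero]
          simp [hJ]
        -- The centre `1/conj w` escapes to infinity as `w → 0`, so small `w` is handled by a
        -- pointwise bound; for `|w| ≥ 1/2` the Jacobian `|w|^(-2)` is at most `4`.
        · rcases lt_or_ge ‖w‖ (1 / 2) with hw2 | hw2
          · refine le_add_right ?_
            rw [← setLIntegral_const]
            refine setLIntegral_mono' isOpen_unitDisk.measurableSet fun z hz => ?_
            have h1 := one_sub_norm_le_norm_one_sub_conj_mul (w := w) (mem_unitDisk_iff.mp hz)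
            exact ENNReal.ofReal_le_ofReal (dilatedProfile_le_of_half_le hp0 hd
              (by linarith [norm_nonneg w]) h1 (by linarith))
          · refine le_add_left ((setLIntegral_le_lintegral _ _).trans ?_)
            have hw0 : conj w ≠ 0 := by
              rw [Ne, map_eq_zero]
              rintro rfl
              norm_num at hw2
            calc _ = ∫⁻ z : ℂ, ENNReal.ofReal
                  (dilatedProfile p (1 - ‖w‖) ‖conj w * (z - (conj w)⁻¹)‖) := by
                  refine lintegral_congr fun z => ?_
                  rw [mul_sub, mul_inv_cancel₀ hw0, norm_sub_rev]
              _ ≤ _ := by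
                  rw [lintegral_dilatedProfile hd hw0, RCLike.norm_conj]
                  gcongr
                  rw [inv_le_comm₀ (by positivity) (by norm_num)]
                  nlinarith

end Radial

/-! ### The weight `1 - |σ_w(z)|²`. -/

section Mobius

variable {w z : ℂ}

theorem one_sub_norm_mobius_sq (hw : ‖w‖ < 1) (hz : ‖z‖ < 1) :
    1 - ‖mobius w z‖ ^ 2 = (1 - ‖w‖ ^ 2) * (1 - ‖z‖ ^ 2) / ‖1 - conj w * z‖ ^ 2 := by
  have h0 : 0 < ‖1 - conj w * z‖ :=
    lt_of_lt_of_le (by linarith) (one_sub_norm_le_norm_one_sub_conj_mul (w := w) hz)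
  have h : ‖1 - conj w * z‖ ^ 2 - ‖w - z‖ ^ 2 = (1 - ‖w‖ ^ 2) * (1 - ‖z‖ ^ 2) := by
    simp only [Complex.sq_norm, Complex.normSq_apply, Complex.sub_re, Complex.sub_im,
      Complex.mul_re, Complex.mul_im, Complex.conj_re, Complex.conj_im, Complex.one_re,
      Complex.one_im]
    ring
  rw [mobius, norm_div, div_pow, ← h, sub_div, div_self (by positivity)]

theorem one_sub_norm_mobius_sq_nonneg (hw : ‖w‖ < 1) (hz : ‖z‖ < 1) :
    0 ≤ 1 - ‖mobius w z‖ ^ 2 := by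
  rw [one_sub_norm_mobius_sq hw hz]
  have h1 : 0 ≤ 1 - ‖w‖ ^ 2 := by nlinarith [norm_nonneg w]
  have h2 : 0 ≤ 1 - ‖z‖ ^ 2 := by nlinarith [norm_nonneg z]
  positivity

theorem one_sub_norm_mobius_sq_le (hw : ‖w‖ < 1) (hz : ‖z‖ < 1) :
    1 - ‖mobius w z‖ ^ 2 ≤ 4 * ((1 - ‖w‖) * (1 - ‖z‖) * (‖1 - conj w * z‖ ^ 2)⁻¹) := by
  rw [one_sub_norm_mobius_sq hw hz, div_eq_mul_inv, ← mul_assoc]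
  refine mul_le_mul_of_nonneg_right ?_ (by positivity)
  have h1 : 1 - ‖w‖ ^ 2 ≤ 2 * (1 - ‖w‖) := by nlinarith [norm_nonneg w]
  have h2 : 1 - ‖z‖ ^ 2 ≤ 2 * (1 - ‖z‖) := by nlinarith [norm_nonneg z]
  have h3 : 0 ≤ 1 - ‖z‖ ^ 2 := by nlinarith [norm_nonneg z]
  calc _ ≤ 2 * (1 - ‖w‖) * (2 * (1 - ‖z‖)) :=
        mul_le_mul h1 h2 h3 (by linarith)
    _ = _ := by ring

end Mobius

/-! ### Carleson measures map `H^∞` into `Q_p`. -/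

section Sufficiency

variable {p : ℝ} {μ : Measure (Set.Ico (0 : ℝ) 1)} [IsFiniteMeasure μ] {f : ℂ → ℂ}

theorem lintegral_normalizedArea_le (g : ℂ → ℝ≥0∞) (s : Set ℂ) :
    ∫⁻ z in s, g z ∂normalizedArea ≤ ∫⁻ z in s, g z := by
  rw [normalizedArea, Measure.restrict_smul, lintegral_smul_measure, smul_eq_mul]
  refine mul_le_of_le_one_left' (ENNReal.inv_le_one.mpr ?_)
  rw [ENNReal.one_le_ofReal]
  linarith [Real.pi_gt_three]

theorem cesaroLike_mem_qSpace_of_carleson (hp0 : 0 < p) (hp2 : p < 2) (hμ : IsCarleson01 μ)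
    (hf : f ∈ hardyInfty) : cesaroLike μ f ∈ qSpace p := by
  refine ⟨cesaroLike_mem_analyticDisk hf, ?_⟩
  -- With `ε = p/2` the squared derivative bound contributes `(1 - |z|)^(-p)`, cancelling the
  -- weight's `(1 - |z|)^p`; `ε < 1` is exactly `p < 2`.
  obtain ⟨K, hK0, hK⟩ := exists_norm_deriv_cesaroLike_le hμ hf
    (show 0 < p / 2 by linarith) (show p / 2 < 1 by linarith)
  obtain ⟨L, hL, hLb⟩ := exists_lintegral_kernel_le hp0 hp2
  refine lt_of_le_of_lt (iSup₂_le fun w hw => ?_)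
    (ENNReal.mul_lt_top (ENNReal.ofReal_lt_top (r := 4 ^ p * K ^ 2)) hL)
  rw [mem_unitDisk_iff] at hw
  refine (lintegral_normalizedArea_le _ _).trans
    (le_trans ?_ (mul_le_mul_right (hLb w hw) (ENNReal.ofReal (4 ^ p * K ^ 2))))
  rw [← lintegral_const_mul' _ _ ENNReal.ofReal_ne_top]
  refine setLIntegral_mono' isOpen_unitDisk.measurableSet fun z hz => ?_
  rw [mem_unitDisk_iff] at hz
  have hd : 0 < 1 - ‖w‖ := by linarith
  have hh : 0 < 1 - ‖z‖ := by linarith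
  have hy := hd.trans_le (one_sub_norm_le_norm_one_sub_conj_mul (w := w) hz)
  rw [← ENNReal.ofReal_mul (by positivity)]
  refine ENNReal.ofReal_le_ofReal ?_
  have e1 : (‖1 - z‖ ^ (p / 2 - 1)) ^ 2 = ‖1 - z‖ ^ (p - 2) := by
    rw [← Real.rpow_mul_natCast (norm_nonneg _)]
    congr 1
    push_cast
    ring
  have e2 : ((1 - ‖z‖) ^ (-(p / 2))) ^ 2 = ((1 - ‖z‖) ^ p)⁻¹ := by
    rw [← Real.rpow_mul_natCast hh.le, ← Real.rpow_neg hh.le]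
    congr 1
    push_cast
    ring
  have e3 : ((‖1 - conj w * z‖ ^ 2)⁻¹) ^ p = ‖1 - conj w * z‖ ^ (-(2 * p)) := by
    rw [Real.inv_rpow (by positivity), Real.rpow_neg hy.le, ← Real.rpow_natCast_mul hy.le]
    norm_cast
  have hhp : (1 - ‖z‖) ^ p ≠ 0 := by positivity
  calc _ ≤ (K * (‖1 - z‖ ^ (p / 2 - 1) * (1 - ‖z‖) ^ (-(p / 2)))) ^ 2
          * (4 * ((1 - ‖w‖) * (1 - ‖z‖) * (‖1 - conj w * z‖ ^ 2)⁻¹)) ^ p := by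
        have h1 := hK z hz
        have h2 := one_sub_norm_mobius_sq_le hw hz
        have h3 := one_sub_norm_mobius_sq_nonneg hw hz
        gcongr
    _ = _ := by
        rw [mul_pow, mul_pow, e1, e2, Real.mul_rpow (by norm_num) (by positivity),
          Real.mul_rpow (by positivity) (by positivity), Real.mul_rpow hd.le hh.le, e3]
        field_simp

end Sufficiency

/-! ### Testing on the constant function `1`. -/

section Necessity

variable {p : ℝ} {μ : Measure (Set.Ico (0 : ℝ) 1)} [IsFiniteMeasure μ]

theorem one_mem_hardyInfty : (fun _ : ℂ => (1 : ℂ)) ∈ hardyInfty :=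
  ⟨differentiableOn_const _, 1, fun _ _ => by simp⟩

theorem inv_le_re_one_div_add_sq {a : ℝ} {v : ℂ} (ha : 0 < a) (hv : ‖v‖ ≤ a / 4) :
    1 / (5 * a ^ 2) ≤ (1 / ((a : ℂ) + v) ^ 2).re := by
  have hre := abs_le.mp ((Complex.abs_re_le_norm v).trans hv)
  have him := abs_le.mp ((Complex.abs_im_le_norm v).trans hv)
  set x := a + v.re with hx
  set y := v.im with hy
  have hx1 : 3 / 4 * a ≤ x := by linarith
  have hx2 : x ≤ 5 / 4 * a := by linarith
  have hx0 : 0 < x := by linarith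
  have hn : 0 < x ^ 2 + y ^ 2 := by positivity
  have he : (1 / ((a : ℂ) + v) ^ 2).re = (x ^ 2 - y ^ 2) / (x ^ 2 + y ^ 2) ^ 2 := by
    rw [one_div, Complex.inv_re, map_pow, Complex.normSq_apply, sq ((a : ℂ) + v), Complex.mul_re]
    simp only [Complex.add_re, Complex.ofReal_re, Complex.add_im, Complex.ofReal_im, zero_add]
    rw [← hx, ← hy, ← sq, ← sq]
  rw [he, div_le_div_iff₀ (by positivity) (by positivity)]
  have hy2 : y ^ 2 ≤ a ^ 2 / 16 := by nlinarith
  have hx3 : 9 / 16 * a ^ 2 ≤ x ^ 2 := by nlinarith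
  have hx4 : x ^ 2 ≤ 25 / 16 * a ^ 2 := by nlinarith
  have h1 : x ^ 2 + y ^ 2 ≤ 26 / 16 * a ^ 2 := by linarith
  have h2 := mul_le_mul_of_nonneg_left h1 hn.le
  -- The coefficients are `5 - 26/16` and `5 + 26/16`, what remains after `h2` is subtracted from
  -- the goal.
  have h3 : 0 ≤ a ^ 2 * (27 / 8 * x ^ 2 - 53 / 8 * y ^ 2) :=
    mul_nonneg (sq_nonneg a) (by linarith)
  linarith

/-- For `f = 1` the kernel derivative is `t/(1 - tz)^2`, whose real part is nonnegative near `r` for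
every `t`. The part `t < r` can be dropped, and `1 - tr ≤ 2(1 - r)` on the rest. -/
theorem re_deriv_cesaroLike_one_ge {r : ℝ} (hr0 : 0 ≤ r) (hr1 : r < 1) {z : ℂ}
    (hz : ‖z‖ < 1) (hzr : ‖z - r‖ ≤ (1 - r) / 4) :
    μ.real (Set.Ici ⟨r, hr0, hr1⟩) * (r / (20 * (1 - r) ^ 2))
      ≤ (deriv (cesaroLike μ fun _ => 1) z).re := by
  obtain ⟨hint, hder⟩ := hasDerivAt_cesaroLike (μ := μ) one_mem_hardyInfty hz
  rw [hder.deriv, ← Complex.reCLM_apply, ← Complex.reCLM.integral_comp_comm hint, ← smul_eq_mul,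
    ← integral_indicator_const _ measurableSet_Ici]
  refine integral_mono ((integrable_const _).indicator measurableSet_Ici)
    (Complex.reCLM.integrable_comp hint) fun t => ?_
  have hker : cesaroKernelDeriv (fun _ => 1) t z
      = ((t : ℝ) : ℂ) * (1 / (((1 - t * r : ℝ) : ℂ) + -((t : ℝ) * (z - r))) ^ 2) := by
    rw [show ((1 - t * r : ℝ) : ℂ) + -((t : ℝ) * (z - r)) = 1 - (t : ℝ) * z by push_cast; ring]
    simp [cesaroKernelDeriv, div_eq_mul_inv]
  have htr : (t : ℝ) * r ≤ r := mul_le_of_le_one_left hr0 t.2.2.le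
  have ha : 0 < 1 - (t : ℝ) * r := by linarith
  have hre := inv_le_re_one_div_add_sq (a := 1 - t * r) (v := -((t : ℝ) * (z - r))) ha (by
    rw [norm_neg, norm_ofReal_mul_of_nonneg t.2.1]
    have : (t : ℝ) * ‖z - r‖ ≤ ‖z - r‖ := mul_le_of_le_one_left (norm_nonneg _) t.2.2.le
    linarith)
  simp only [Complex.reCLM_apply]
  rw [hker, Complex.re_ofReal_mul]
  by_cases ht : t ∈ Set.Ici (⟨r, hr0, hr1⟩ : Set.Ico (0 : ℝ) 1)
  · rw [Set.indicator_of_mem ht]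
    have htr' : r ≤ t := ht
    have h2 : 1 - (t : ℝ) * r ≤ 2 * (1 - r) := by nlinarith
    calc r / (20 * (1 - r) ^ 2) = r * (1 / (5 * (2 * (1 - r)) ^ 2)) := by
          rw [mul_one_div]; ring_nf
      _ ≤ t * (1 / (5 * (1 - t * r) ^ 2)) := by
          have := t.2.1
          gcongr
      _ ≤ _ := mul_le_mul_of_nonneg_left hre t.2.1
  · rw [Set.indicator_of_notMem ht]
    exact mul_nonneg t.2.1 (le_trans (by positivity) hre)

theorem normalizedArea_ball (c : ℂ) (r : ℝ) :
    normalizedArea (ball c r) = ENNReal.ofReal r ^ 2 := by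
  have h : ENNReal.ofReal Real.pi ≠ 0 := by simpa using Real.pi_pos
  rw [normalizedArea, Measure.smul_apply, Complex.volume_ball, smul_eq_mul,
    show (NNReal.pi : ℝ≥0∞) = ENNReal.ofReal Real.pi by
      rw [← NNReal.coe_real_pi, ENNReal.ofReal_coe_nnreal],
    mul_comm (ENNReal.ofReal r ^ 2), ← mul_assoc, ENNReal.inv_mul_cancel h ENNReal.ofReal_ne_top,
    one_mul]

/-- Take `w = r` and restrict to the disk of radius `(1 - r)/4` about `r`, where `|σ_r| ≤ 1/4`. -/
theorem ofReal_le_qSeminormSq_cesaroLike_one (hp0 : 0 < p) {r : ℝ} (hr0 : 0 ≤ r) (hr1 : r < 1) :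
    ENNReal.ofReal ((μ.real (Set.Ici ⟨r, hr0, hr1⟩) * (r / (20 * (1 - r) ^ 2))) ^ 2
        * (1 / 2) ^ p * ((1 - r) / 4) ^ 2)
      ≤ qSeminormSq p (cesaroLike μ fun _ => 1) := by
  have hr : 0 < 1 - r := by linarith
  have hrn : ‖(r : ℂ)‖ = r := Complex.norm_of_nonneg hr0
  have hsub : ball (r : ℂ) ((1 - r) / 4) ⊆ unitDisk := fun z hz => by
    rw [mem_ball, dist_eq_norm] at hz
    rw [mem_unitDisk_iff]
    have := norm_le_norm_add_norm_sub' z (r : ℂ)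
    linarith
  refine le_trans ?_ (le_iSup₂_of_le (f := fun w (_ : w ∈ unitDisk) => ∫⁻ z in unitDisk,
    ENNReal.ofReal (‖deriv (cesaroLike μ fun _ => 1) z‖ ^ 2 * (1 - ‖mobius w z‖ ^ 2) ^ p)
      ∂normalizedArea) (r : ℂ) (by rwa [mem_unitDisk_iff, hrn])
    (lintegral_mono_set hsub))
  rw [ENNReal.ofReal_mul (by positivity), ENNReal.ofReal_pow (by positivity),
    ← normalizedArea_ball (r : ℂ), ← setLIntegral_const]
  refine setLIntegral_mono' measurableSet_ball fun z hz => ENNReal.ofReal_le_ofReal ?_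
  have hz1 := mem_unitDisk_iff.mp (hsub hz)
  rw [mem_ball, dist_eq_norm] at hz
  have h1 := (re_deriv_cesaroLike_one_ge (μ := μ) hr0 hr1 hz1 hz.le).trans
    (Complex.re_le_norm _)
  have h2 : ‖mobius r z‖ ≤ 1 / 4 := by
    have h3 := one_sub_norm_le_norm_one_sub_conj_mul (w := (r : ℂ)) hz1
    rw [hrn] at h3
    rw [mobius, norm_div, div_le_iff₀ (hr.trans_le h3), norm_sub_rev]
    linarith
  have h3 : 1 / 2 ≤ 1 - ‖mobius r z‖ ^ 2 := by nlinarith [norm_nonneg (mobius r z)]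
  gcongr

theorem isCarleson01_of_one (hp0 : 0 < p) (h : cesaroLike μ (fun _ => 1) ∈ qSpace p) :
    IsCarleson01 μ := by
  set Q := (qSeminormSq p (cesaroLike μ fun _ => 1)).toReal 
  have hQ0 : 0 ≤ Q := ENNReal.toReal_nonneg
  -- `6400 = 20² · 4²`, from the derivative bound and the disk radius.
  set B := Real.sqrt (6400 * 2 ^ p * Q) with hB
  have hB0 : 0 ≤ B := Real.sqrt_nonneg _
  have hm0 : 0 ≤ μ.real Set.univ := measureReal_nonneg
  -- `2B` serves `r ≥ 1/2`, where `m ≤ 2mr`; twice the total mass serves `r < 1/2`; the `1` ensures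
  -- positivity.
  refine ⟨2 * B + 2 * μ.real Set.univ + 1, by positivity, fun ⟨r, hr0, hr1⟩ => ?_⟩
  rw [← ofReal_measureReal]
  refine ENNReal.ofReal_le_ofReal ?_
  have hle := ofReal_le_qSeminormSq_cesaroLike_one (μ := μ) hp0 hr0 hr1
  rw [← ENNReal.ofReal_toReal h.2.ne, ENNReal.ofReal_le_ofReal_iff hQ0] at hle
  have hr : 0 < 1 - r := by linarith
  set m := μ.real (Set.Ici ⟨r, hr0, hr1⟩)
  have hm1 : 0 ≤ m := measureReal_nonneg
  simp only
  rcases lt_or_ge r (1 / 2) with h2 | h2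
  · have : m ≤ μ.real Set.univ := measureReal_mono (Set.subset_univ _)
    nlinarith
  · have hsq : (m * r) ^ 2 ≤ (B * (1 - r)) ^ 2 := by
      rw [mul_pow B, hB, Real.sq_sqrt (by positivity)]
      have h2p : (0 : ℝ) < 2 ^ p := by positivity
      have e : (m * (r / (20 * (1 - r) ^ 2))) ^ 2 * (1 / 2) ^ p * ((1 - r) / 4) ^ 2
          = (m * r) ^ 2 / (6400 * 2 ^ p * (1 - r) ^ 2) := by
        rw [Real.div_rpow zero_le_one zero_le_two, Real.one_rpow]
        field_simp
        ring
      rw [e, div_le_iff₀ (by positivity)] at hle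
      linarith
    have hle2 := (abs_le_of_sq_le_sq' hsq (by positivity)).2
    nlinarith

end Necessity

theorem mainTheorem1 (p : ℝ) (hp0 : 0 < p) (hp2 : p < 2)
    (μ : MeasureTheory.Measure (Set.Ico (0 : ℝ) 1)) [MeasureTheory.IsFiniteMeasure μ] :
    cesaroLike μ '' hardyInfty ⊆ qSpace p ↔ IsCarleson01 μ := by
  constructor
  · exact fun h => isCarleson01_of_one hp0 (h (Set.mem_image_of_mem _ one_mem_hardyInfty))
  · rintro hμ _ ⟨f, hf, rfl⟩
    exact cesaroLike_mem_qSpace_of_carleson hp0 hp2 hμ hf
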